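/- Let $n\ge 3$, $p\ge 2$, let $W_i=(X_i,Y_i)$, $i=1,\dots,n$, be independent copies of a random element $W=(X,Y)$ of $\mathcal W\subseteq\mathbb R^p\times\mathcal Y$, let $m:\mathbb R\times\mathcal Y\to\mathbb R$ be a measurable loss, $\Theta\subseteq\mathbb R^p$, and $\theta_0\in\mathbb R^p$ with support $T=\{j:\theta_{0j}\ne 0\}$ and $s=|T|\ge 1$. Write $\mathbb E_n[f(W_i)]=n^{-1}\sum_{i=1}^n f(W_i)$. Fix $c_0>1$, put $\overline c_0=(c_0+1)/(c_0-1)$, and for $u>0$ let $$\epsilon(u)=\sup_{\delta}\Bigl|(\mathbb E_n-\mathrm E)\bigl[m(X_i^\top(\theta_0+\delta),Y_i)-m(X_i^\top\theta_0,Y_i)\bigr]\Bigr|,$$ the supremum being over all $\delta\in\mathbb R^p$ with $\|\delta_{T^c}\|_1\le\overline c_0\|\delta_T\|_1$, $\theta_0+\delta\in\Theta$ and $\|\delta\|_2\le u$ (where $\delta_J$ is $\delta$ with the coordinates outside $J$ set to zero). Assume that there are constants $\zeta_n>0$, $B_n\ge 1$, $C_X>0$, $c_L>0$, $C_L>0$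 and a measurable function $L:\mathcal W\to[0,\infty)$ such that: 1. $\max_{1\le i\le n}\|X_i\|_\infty\le B_n$ with probability at least $1-\zeta_n$, and $\max_{1\le j\le p}\sum_{i=1}^n X_{ij}^4\le nC_X^4$ with probability at least $1-\zeta_n$; 2. for all $w=(x,y)\in\mathcal W$ and all $t_1,t_2\in[-c_L,c_L]$, $|m(x^\top\theta_0+t_1,y)-m(x^\top\theta_0+t_2,y)|\le L(w)|t_1-t_2|$, and $\mathrm E[L(W)^8]\le(C_L/2)^8$; 3. for all $t\in[0,c_L]$ and $\theta\in\Theta$ with $\|\theta-\theta_0\|_2\le t$, $\mathrm E[\{m(X^\top\theta,Y)-m(X^\top\theta_0,Y)\}^2]\le C_L^2t^2$. Let $C_\epsilon=16\sqrt2\,(1+\overline c_0)C_LC_X$ and suppose that $s\ln(pn)\ge 16C_L^2/C_\epsilon^2$. Then for every $u$ with $0<u\le c_L/[(1+\overline c_0)B_n\sqrt s]$, $$\epsilon(u)\le C_\epsilon\,u\sqrt{s\ln(pn)/n}\quad\text{with probability at least }1-5n^{-1}-8\zeta_n.$$ -/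

import Mathlib

open MeasureTheory ProbabilityTheory
open scoped ENNReal NNReal

noncomputable section

namespace EmpiricalError

/-- The event `E` occurs with probability at least `q`: it contains a measurable event of
probability at least `q`. For measurable `E` this says `q ≤ μ E`; for a possibly non-measurable
`E` (a supremum over an uncountable index set is involved below) it bounds the inner
probability. -/
def WithProbAtLeast {Ω : Type*} [MeasurableSpace Ω] (μ : Measure Ω) (q : ℝ) (E : Set Ω) : Prop :=
  ∃ A : Set Ω, MeasurableSet A ∧ A ⊆ E ∧ q ≤ μ.real A

/-- The `ℓ¹` norm on `ℝᵖ`. (The norm `‖δ‖` of `δ : Fin p → ℝ` is the `ℓ^∞` norm.) -/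
def l1Norm {p : ℕ} (δ : Fin p → ℝ) : ℝ := ‖WithLp.toLp 1 δ‖

/-- The Euclidean norm on `ℝᵖ`. -/
def l2Norm {p : ℕ} (δ : Fin p → ℝ) : ℝ := ‖WithLp.toLp 2 δ‖

/-- The set `T` of indices of the nonzero coefficients of `θ₀`. -/
def activeSet {p : ℕ} (θ₀ : Fin p → ℝ) : Set (Fin p) := {j | θ₀ j ≠ 0}

/-- The number `s` of nonzero coefficients of `θ₀`. -/
def sparsity {p : ℕ} (θ₀ : Fin p → ℝ) : ℕ := (activeSet θ₀).ncard

/-- The vector `δ_J`: equal to `δ` on the coordinates in `J`, and zero on the others. -/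
def restrictTo {p : ℕ} (J : Set (Fin p)) (δ : Fin p → ℝ) : Fin p → ℝ := J.indicator δ

/-- The restricted set `R(c)`. -/
def restrictedSet {p : ℕ} (Θ : Set (Fin p → ℝ)) (θ₀ : Fin p → ℝ) (c : ℝ) : Set (Fin p → ℝ) :=
  {δ | l1Norm (restrictTo (activeSet θ₀)ᶜ δ) ≤ c * l1Norm (restrictTo (activeSet θ₀) δ) ∧
    θ₀ + δ ∈ Θ}

/-- `c̄₀ = (c₀ + 1) / (c₀ - 1)`. -/
def cBar (c₀ : ℝ) : ℝ := (c₀ + 1) / (c₀ - 1)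

/-- The loss difference `m(xᵀθ, y) - m(xᵀθ₀, y)` at `w = (x, y)`. -/
def lossDiff {p : ℕ} {𝒴 : Type*} (m : ℝ → 𝒴 → ℝ) (θ₀ θ : Fin p → ℝ)
    (w : (Fin p → ℝ) × 𝒴) : ℝ :=
  m (w.1 ⬝ᵥ θ) w.2 - m (w.1 ⬝ᵥ θ₀) w.2

/-- The centred empirical average `(𝔼ₙ - E) f`, for data `w₁, …, wₙ` and distribution `P`. -/
def centeredAvg {𝒵 : Type*} [MeasurableSpace 𝒵] {n : ℕ} (P : Measure 𝒵) (w : Fin n → 𝒵)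
    (f : 𝒵 → ℝ) : ℝ :=
  (n : ℝ)⁻¹ * ∑ i, f (w i) - ∫ z, f z ∂P

/-- The empirical error function `ε(u)` evaluated at the data `w₁, …, wₙ`; the supremum is taken
in `[0, ∞]`, so that it is never a default value. -/
def empiricalError {p n : ℕ} {𝒴 : Type*} [MeasurableSpace 𝒴] (P : Measure ((Fin p → ℝ) × 𝒴))
    (m : ℝ → 𝒴 → ℝ) (Θ : Set (Fin p → ℝ)) (θ₀ : Fin p → ℝ) (c₀ : ℝ)
    (w : Fin n → (Fin p → ℝ) × 𝒴) (u : ℝ) : ℝ≥0∞ :=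
  ⨆ δ ∈ {δ : Fin p → ℝ | δ ∈ restrictedSet Θ θ₀ (cBar c₀) ∧ l2Norm δ ≤ u},
    ENNReal.ofReal |centeredAvg P w (lossDiff m θ₀ (θ₀ + δ))|

/-- `W₁, …, Wₙ` are independent random elements with common distribution `P`. -/
structure IsIIDSample {Ω 𝒵 : Type*} [MeasurableSpace Ω] [MeasurableSpace 𝒵] {n : ℕ}
    (μ : Measure Ω) (P : Measure 𝒵) (W : Fin n → Ω → 𝒵) : Prop where
  measurable : ∀ i, Measurable (W i)
  law : ∀ i, μ.map (W i) = P
  indep : iIndepFun W μ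

/-- The covariate condition, at a given sample size `n`: with probability at least `1 - ζ` all
covariates are bounded by `B`, and with probability at least `1 - ζ` their empirical fourth
moments are bounded by `C_X ^ 4`. -/
structure CovariateCondition {Ω 𝒴 : Type*} [MeasurableSpace Ω] {p n : ℕ} (μ : Measure Ω)
    (W : Fin n → Ω → (Fin p → ℝ) × 𝒴) (ζ B C_X : ℝ) : Prop where
  zeta_pos : 0 < ζ
  one_le_B : 1 ≤ B
  C_X_pos : 0 < C_X
  bounded : WithProbAtLeast μ (1 - ζ) {ω | ∀ i, ‖(W i ω).1‖ ≤ B}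
  moment : WithProbAtLeast μ (1 - ζ) {ω | ∀ j, ∑ i, (W i ω).1 j ^ 4 ≤ n * C_X ^ 4}

/-- The local loss condition: the loss is locally Lipschitz in the index around `xᵀθ₀` with a
Lipschitz constant `L(w)` whose eighth moment is controlled, and is mean-square continuous
at `θ₀`. The expectations are integrals of nonnegative functions with values in `[0, ∞]`, so that
the bounds include finiteness. -/
structure LocalLossCondition {p : ℕ} {𝒴 : Type*} [MeasurableSpace 𝒴]
    (P : Measure ((Fin p → ℝ) × 𝒴)) (𝒲 : Set ((Fin p → ℝ) × 𝒴)) (m : ℝ → 𝒴 → ℝ)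
    (Θ : Set (Fin p → ℝ)) (θ₀ : Fin p → ℝ)
    (L : (Fin p → ℝ) × 𝒴 → ℝ≥0) (c_L C_L : ℝ) : Prop where
  c_L_pos : 0 < c_L
  C_L_pos : 0 < C_L
  measurable_L : Measurable L
  lipschitz : ∀ w ∈ 𝒲, ∀ t₁ t₂ : ℝ, max |t₁| |t₂| ≤ c_L →
    |m (w.1 ⬝ᵥ θ₀ + t₁) w.2 - m (w.1 ⬝ᵥ θ₀ + t₂) w.2| ≤ L w * |t₁ - t₂|
  moment : ∫⁻ w, (L w : ℝ≥0∞) ^ 8 ∂P ≤ ENNReal.ofReal ((C_L / 2) ^ 8)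
  meanSquare : ∀ t ∈ Set.Icc 0 c_L, ∀ θ ∈ Θ, l2Norm (θ - θ₀) ≤ t →
    ∫⁻ w, ENNReal.ofReal (lossDiff m θ₀ θ w ^ 2) ∂P ≤ ENNReal.ofReal (C_L ^ 2 * t ^ 2)

/-- The constant `C_ε = 16 √2 (1 + c̄₀) C_L C_X`. -/
def Ceps (c₀ C_L C_X : ℝ) : ℝ := 16 * √2 * (1 + cBar c₀) * C_L * C_X

end EmpiricalError

end

/-!
The law of the sample is a product measure, on which the argument takes place. By mean-square
continuity and Chebyshev's inequality, each single centred average stays below half the target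
level with probability at least `3 / 4`; this is what the side condition on `s ln(pn)` provides.
Comparing the sample with an independent copy and exchanging corresponding coordinates at random
therefore bounds the probability of a large supremum by that of a large Rademacher process
(`symmetrization`).

Conditionally on a regular sample (`regularSamples`), the loss differences are Lipschitz functions
of the indices `⟨X_i, δ⟩`, because `|⟨X_i, δ⟩| ≤ ‖X_i‖_∞ ‖δ‖₁ ≤ c_L` on the restricted cone. The
contraction principle for exponential moments (`contraction`) replaces the Rademacher process by the
linear one with coefficients `L(W_i) X_i`, whose supremum over an `ℓ¹` ball is a maximum over `p`
sub-Gaussian coordinates (`card_signs_abs_lt_le`). The coordinate variances are controlled by the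
Cauchy-Schwarz inequality, from the fourth empirical moments of `X` and of `L(W)`; the latter
concentrate because `L(W)` has eight moments.

All this is done for finitely many directions `δ`, then for a sequence by monotone limits. Under
bounded covariates the empirical part is continuous in `δ`, but the expected loss difference need
not be. The supremum is therefore reduced to a sequence that is dense for the graph topology of the
expected loss difference (`exists_seq_dense_graph`, `abs_centeredAvg_le_of_dense`).
-/

open MeasureTheory ProbabilityTheory
open scoped ENNReal NNReal

namespace EmpiricalError

/-! ### Rademacher processes and contraction -/

/-- The value `±1` of a Rademacher sign. Sign vectors are encoded as functions `Fin n → Bool`, and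
Rademacher probabilities and expectations as counts and sums over them. -/
def sgn (b : Bool) : ℝ := if b then 1 else -1

@[simp] lemma sgn_true : sgn true = 1 := rfl
@[simp] lemma sgn_false : sgn false = -1 := rfl

/-- A two-point case of the majorization inequality for `exp`. -/
lemma exp_add_exp_le_of_majorized {A B M m : ℝ} (hA : A ≤ M) (hB : B ≤ M)
    (hAB : A + B ≤ M + m) : Real.exp A + Real.exp B ≤ Real.exp M + Real.exp m := by
  rcases le_total A m with h | h
  · linarith [Real.exp_le_exp.2 h, Real.exp_le_exp.2 hB]
  · have h1 : Real.exp B ≤ Real.exp (M + m - A) := Real.exp_le_exp.2 (by linarith)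
    have h2 : Real.exp (M + m - A) = Real.exp M * Real.exp (m - A) := by
      rw [← Real.exp_add]; ring_nf
    have h3 : Real.exp m = Real.exp A * Real.exp (m - A) := by
      rw [← Real.exp_add]; ring_nf
    have h4 : Real.exp (m - A) ≤ 1 := Real.exp_le_one_iff.2 (by linarith)
    nlinarith [mul_nonneg (sub_nonneg.2 (Real.exp_le_exp.2 hA)) (sub_nonneg.2 h4)]

/-- The contraction principle for a single sign: since `|g k| ≤ |b k|`, both suprema on the left are
at most the larger one on the right, and their sum is at most the sum on the right. -/
lemma contraction_single {κ : Type*} [Finite κ] [Nonempty κ] (a g b : κ → ℝ)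
    (hg : ∀ k, |g k| ≤ |b k|) (hgg : ∀ k l, |g k - g l| ≤ |b k - b l|) :
    Real.exp (⨆ k, (a k + g k)) + Real.exp (⨆ k, (a k - g k)) ≤
      Real.exp (⨆ k, (a k + b k)) + Real.exp (⨆ k, (a k - b k)) := by
  have hp (k) : a k + b k ≤ ⨆ k, (a k + b k) :=
    le_ciSup (f := fun k => a k + b k) (Set.finite_range _).bddAbove k
  have hm (k) : a k - b k ≤ ⨆ k, (a k - b k) :=
    le_ciSup (f := fun k => a k - b k) (Set.finite_range _).bddAbove k
  set M₁ := ⨆ k, (a k + b k)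
  set M₂ := ⨆ k, (a k - b k)
  obtain ⟨k, hk⟩ := exists_eq_ciSup_of_finite (f := fun k => a k + g k)
  obtain ⟨l, hl⟩ := exists_eq_ciSup_of_finite (f := fun k => a k - g k)
  rw [← hk, ← hl]
  have key (j) : a j + |b j| ≤ max M₁ M₂ := by
    rcases abs_cases (b j) with h | h
    · exact le_max_of_le_left (by linarith [hp j])
    · exact le_max_of_le_right (by linarith [hm j])
  have hA : a k + g k ≤ max M₁ M₂ := by linarith [key k, hg k, le_abs_self (g k)]
  have hB : a l - g l ≤ max M₁ M₂ := by linarith [key l, hg l, neg_abs_le (g l)]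
  have hAB : (a k + g k) + (a l - g l) ≤ M₁ + M₂ := by
    have h1 := hgg k l
    have h2 := le_abs_self (g k - g l)
    rcases abs_cases (b k - b l) with h | h
    · linarith [hp k, hm l]
    · linarith [hp l, hm k]
  rcases le_total M₁ M₂ with h | h
  · rw [max_eq_right h] at hA hB
    linarith [exp_add_exp_le_of_majorized hA hB (m := M₁) (by linarith)]
  · rw [max_eq_left h] at hA hB
    exact exp_add_exp_le_of_majorized hA hB hAB

lemma sum_signs_succ {n : ℕ} (F : (Fin (n + 1) → Bool) → ℝ) :
    ∑ σ, F σ = ∑ τ : Fin n → Bool, (F (Fin.cons true τ) + F (Fin.cons false τ)) := by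
  rw [← (Fin.consEquiv fun _ => Bool).sum_comp, Fintype.sum_prod_type_right]
  simp [Fin.consEquiv]

/-- The **contraction principle** for exponential moments of suprema of Rademacher sums: replacing
the values `b k i` by contractions `g k i` of them decreases the exponential moment. -/
lemma contraction {κ : Type*} [Finite κ] [Nonempty κ] {n : ℕ} (a : κ → ℝ) (g b : κ → Fin n → ℝ)
    (hg : ∀ k i, |g k i| ≤ |b k i|) (hgg : ∀ k l i, |g k i - g l i| ≤ |b k i - b l i|) :
    ∑ σ : Fin n → Bool, Real.exp (⨆ k, (a k + ∑ i, sgn (σ i) * g k i)) ≤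
      ∑ σ : Fin n → Bool, Real.exp (⨆ k, (a k + ∑ i, sgn (σ i) * b k i)) := by
  induction n generalizing a with
  | zero => simp
  | succ n ih =>
    have split (h : κ → Fin (n + 1) → ℝ) (a' : κ → ℝ) (c : Bool) (τ : Fin n → Bool) (k) :
        a' k + ∑ i, sgn ((Fin.cons c τ : Fin (n + 1) → Bool) i) * h k i =
          (a' k + sgn c * h k 0) + ∑ i, sgn (τ i) * h k i.succ := by
      rw [Fin.sum_univ_succ]; simp [add_assoc]
    simp only [sum_signs_succ, split]
    calc _ ≤ ∑ τ : Fin n → Bool,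
          (Real.exp (⨆ k, ((a k + sgn true * g k 0) + ∑ i, sgn (τ i) * b k i.succ)) +
            Real.exp (⨆ k, ((a k + sgn false * g k 0) + ∑ i, sgn (τ i) * b k i.succ))) := by
          rw [Finset.sum_add_distrib, Finset.sum_add_distrib]
          exact add_le_add
            (ih _ _ _ (fun k i => hg k i.succ) (fun k l i => hgg k l i.succ))
            (ih _ _ _ (fun k i => hg k i.succ) (fun k l i => hgg k l i.succ))
      _ ≤ _ := by
          refine Finset.sum_le_sum fun τ _ => ?_
          have := contraction_single (fun k => a k + ∑ i, sgn (τ i) * b k i.succ)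
            (fun k => g k 0) (fun k => b k 0) (fun k => hg k 0) (fun k l => hgg k l 0)
          simpa [sub_eq_add_neg, add_right_comm] using this

/-- Rademacher sums are sub-Gaussian. -/
lemma sum_exp_signs_le {n : ℕ} (c : Fin n → ℝ) :
    ∑ σ : Fin n → Bool, Real.exp (∑ i, sgn (σ i) * c i) ≤
      2 ^ n * Real.exp ((∑ i, c i ^ 2) / 2) := by
  have h : ∑ σ : Fin n → Bool, Real.exp (∑ i, sgn (σ i) * c i) = ∏ i, (2 * Real.cosh (c i)) := by
    simp only [Real.exp_sum]
    rw [← Fintype.prod_sum (fun i (b : Bool) => Real.exp (sgn b * c i))]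
    refine Finset.prod_congr rfl fun i _ => ?_
    simp [Real.cosh_eq]; ring
  rw [h, Finset.prod_mul_distrib, Finset.prod_const, Finset.card_univ, Fintype.card_fin,
    Finset.sum_div, Real.exp_sum]
  gcongr with i
  exact Real.cosh_le_exp_half_sq _

/-- Exponential bound for the one-sided deviations of a Rademacher process whose increments are
dominated by those of the linear process `∑ i, σ i * ⟨v i, δ⟩`, over `δ` in an `ℓ¹` ball. -/
lemma card_signs_lt_le {κ : Type*} [Finite κ] {n p : ℕ} (g : κ → Fin n → ℝ)
    (v : Fin n → Fin p → ℝ) (δ : κ → Fin p → ℝ) {R V r : ℝ} (hp : 0 < p)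
    (hR : 0 < R) (hV : 0 < V) (hr : 0 < r)
    (hg : ∀ k i, |g k i| ≤ |v i ⬝ᵥ δ k|)
    (hgg : ∀ k l i, |g k i - g l i| ≤ |v i ⬝ᵥ δ k - v i ⬝ᵥ δ l|)
    (hδ : ∀ k, ∑ j, |δ k j| ≤ R) (hv : ∀ j, ∑ i, v i j ^ 2 ≤ V) :
    (Nat.card {σ : Fin n → Bool // ∃ k, r < ∑ i, sgn (σ i) * g k i} : ℝ) ≤
      2 ^ n * (2 * p * Real.exp (-(r ^ 2 / (2 * R ^ 2 * V)))) := by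
  classical
  have : Nonempty (Fin p) := ⟨⟨0, hp⟩⟩
  rcases isEmpty_or_nonempty κ with hκ | hκ
  · simp; positivity
  -- the optimal exponent in the Chernoff bound
  set lam : ℝ := r / (R ^ 2 * V) with hlam
  have hlam0 : 0 < lam := by positivity
  have hcard : (Nat.card {σ : Fin n → Bool // ∃ k, r < ∑ i, sgn (σ i) * g k i} : ℝ) *
      Real.exp (lam * r) ≤
      ∑ σ : Fin n → Bool, Real.exp (⨆ k, (0 + ∑ i, sgn (σ i) * (lam * g k i))) := by
    rw [Nat.card_eq_fintype_card, Fintype.card_subtype, ← nsmul_eq_mul, ← Finset.sum_const]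
    refine (Finset.sum_le_sum fun σ hσ => ?_).trans
      (Finset.sum_le_sum_of_subset_of_nonneg (Finset.subset_univ _)
        fun _ _ _ => (Real.exp_pos _).le)
    obtain ⟨k, hk⟩ := (Finset.mem_filter.1 hσ).2
    refine Real.exp_le_exp.2 (le_trans ?_ (le_ciSup (Set.finite_range _).bddAbove k))
    have : 0 + ∑ i, sgn (σ i) * (lam * g k i) = lam * ∑ i, sgn (σ i) * g k i := by
      rw [zero_add, Finset.mul_sum]; exact Finset.sum_congr rfl fun i _ => by ring
    rw [this]
    gcongr
  have hcontr := contraction (fun _ : κ => (0 : ℝ)) (fun k i => lam * g k i)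
    (fun k i => lam * (v i ⬝ᵥ δ k))
    (fun k i => by rw [abs_mul, abs_mul]; exact mul_le_mul_of_nonneg_left (hg k i) (abs_nonneg _))
    (fun k l i => by
      rw [← mul_sub, ← mul_sub, abs_mul, abs_mul]
      exact mul_le_mul_of_nonneg_left (hgg k l i) (abs_nonneg _))
  -- Hölder's inequality for the linear process
  have hsup (σ : Fin n → Bool) :
      Real.exp (⨆ k, (0 + ∑ i, sgn (σ i) * (lam * (v i ⬝ᵥ δ k)))) ≤
        ∑ j, (Real.exp (∑ i, sgn (σ i) * (lam * R * v i j)) +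
          Real.exp (∑ i, sgn (σ i) * (-(lam * R) * v i j))) := by
    obtain ⟨k, hk⟩ := exists_eq_ciSup_of_finite
      (f := fun k => (0 + ∑ i, sgn (σ i) * (lam * (v i ⬝ᵥ δ k))))
    rw [← hk]
    set S : Fin p → ℝ := fun j => ∑ i, sgn (σ i) * v i j with hS
    have e1 (c : ℝ) (j) : ∑ i, sgn (σ i) * (c * v i j) = c * S j := by
      rw [hS, Finset.mul_sum]; exact Finset.sum_congr rfl fun i _ => by ring
    have e2 : 0 + ∑ i, sgn (σ i) * (lam * (v i ⬝ᵥ δ k)) = lam * ∑ j, S j * δ k j := by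
      simp only [dotProduct, hS, zero_add, Finset.mul_sum, Finset.sum_mul]
      rw [Finset.sum_comm]
      exact Finset.sum_congr rfl fun i _ => Finset.sum_congr rfl fun j _ => by ring
    simp only [e1, e2]
    obtain ⟨j, hj⟩ := exists_eq_ciSup_of_finite (f := fun j => |S j|)
    have hle : ∑ j, S j * δ k j ≤ R * |S j| := by
      calc ∑ l, S l * δ k l ≤ ∑ l, |S j| * |δ k l| := by
            refine Finset.sum_le_sum fun l _ => (le_abs_self _).trans ?_
            rw [abs_mul]
            exact mul_le_mul_of_nonneg_right
              ((le_ciSup (f := fun j => |S j|) (Set.finite_range _).bddAbove l).trans hj.ge)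
              (abs_nonneg _)
        _ ≤ |S j| * R := by rw [← Finset.mul_sum]; gcongr; exact hδ k
        _ = R * |S j| := mul_comm _ _
    have hexp : Real.exp (lam * (R * |S j|)) ≤
        Real.exp (lam * R * S j) + Real.exp (-(lam * R) * S j) := by
      rcases abs_cases (S j) with h | h <;> rw [h.1]
      · rw [← mul_assoc]; linarith [Real.exp_pos (-(lam * R) * S j)]
      · rw [show lam * (R * -S j) = -(lam * R) * S j by ring]
        linarith [Real.exp_pos (lam * R * S j)]
    calc _ ≤ Real.exp (lam * (R * |S j|)) := by gcongr
      _ ≤ _ := hexp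
      _ ≤ _ := Finset.single_le_sum
        (f := fun j => Real.exp (lam * R * S j) + Real.exp (-(lam * R) * S j))
        (fun j _ => by positivity) (Finset.mem_univ j)
  have hgauss (c : ℝ) (hc : c ^ 2 = (lam * R) ^ 2) (j) :
      ∑ σ : Fin n → Bool, Real.exp (∑ i, sgn (σ i) * (c * v i j)) ≤
        2 ^ n * Real.exp ((lam * R) ^ 2 * V / 2) := by
    refine (sum_exp_signs_le _).trans ?_
    gcongr
    simp only [mul_pow c, hc, ← Finset.mul_sum]
    gcongr
    exact hv j
  have hsum : ∑ σ : Fin n → Bool, ∑ j, (Real.exp (∑ i, sgn (σ i) * (lam * R * v i j)) +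
        Real.exp (∑ i, sgn (σ i) * (-(lam * R) * v i j))) ≤
      2 ^ n * (2 * p * Real.exp ((lam * R) ^ 2 * V / 2)) := by
    rw [Finset.sum_comm]
    calc _ ≤ ∑ j : Fin p, (2 * (2 ^ n * Real.exp ((lam * R) ^ 2 * V / 2))) := by
          refine Finset.sum_le_sum fun j _ => ?_
          rw [Finset.sum_add_distrib]
          linarith [hgauss (lam * R) rfl j, hgauss (-(lam * R)) (by ring) j]
      _ = _ := by simp; ring
  have htot := (hcard.trans hcontr).trans ((Finset.sum_le_sum fun σ _ => hsup σ).trans hsum)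
  rw [← le_div_iff₀ (Real.exp_pos _)] at htot
  refine htot.trans (le_of_eq ?_)
  rw [mul_div_assoc, mul_div_assoc, ← Real.exp_sub]
  congr 4
  rw [hlam]; field_simp; ring

/-- Two-sided form of `card_signs_lt_le`. -/
lemma card_signs_abs_lt_le {κ : Type*} [Finite κ] {n p : ℕ} (g : κ → Fin n → ℝ)
    (v : Fin n → Fin p → ℝ) (δ : κ → Fin p → ℝ) {R V r : ℝ} (hp : 0 < p)
    (hR : 0 < R) (hV : 0 < V) (hr : 0 < r)
    (hg : ∀ k i, |g k i| ≤ |v i ⬝ᵥ δ k|)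
    (hgg : ∀ k l i, |g k i - g l i| ≤ |v i ⬝ᵥ δ k - v i ⬝ᵥ δ l|)
    (hδ : ∀ k, ∑ j, |δ k j| ≤ R) (hv : ∀ j, ∑ i, v i j ^ 2 ≤ V) :
    (Nat.card {σ : Fin n → Bool // ∃ k, r < |∑ i, sgn (σ i) * g k i|} : ℝ) ≤
      2 ^ n * (4 * p * Real.exp (-(r ^ 2 / (2 * R ^ 2 * V)))) := by
  classical
  have h1 := card_signs_lt_le g v δ hp hR hV hr hg hgg hδ hv
  have h2 := card_signs_lt_le (fun k i => -g k i) v δ hp hR hV hr (by simpa using hg)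
    (fun k l i => by
      rw [show -g k i - -g l i = -(g k i - g l i) by ring, abs_neg]; exact hgg k l i) hδ hv
  have h3 : Nat.card {σ : Fin n → Bool // ∃ k, r < |∑ i, sgn (σ i) * g k i|} ≤
      Nat.card {σ : Fin n → Bool // ∃ k, r < ∑ i, sgn (σ i) * g k i} +
      Nat.card {σ : Fin n → Bool // ∃ k, r < ∑ i, sgn (σ i) * -g k i} := by
    simp only [Nat.card_eq_fintype_card, Fintype.card_subtype]
    refine le_trans (Finset.card_le_card fun σ hσ => ?_) (Finset.card_union_le _ _)
    obtain ⟨k, hk⟩ := (Finset.mem_filter.1 hσ).2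
    simp only [Finset.mem_union, Finset.mem_filter, Finset.mem_univ, true_and]
    rcases lt_abs.1 hk with h | h
    · exact Or.inl ⟨k, h⟩
    · exact Or.inr ⟨k, by simpa [Finset.sum_neg_distrib] using h⟩
  have h3' : (Nat.card {σ : Fin n → Bool // ∃ k, r < |∑ i, sgn (σ i) * g k i|} : ℝ) ≤
      Nat.card {σ : Fin n → Bool // ∃ k, r < ∑ i, sgn (σ i) * g k i} +
      Nat.card {σ : Fin n → Bool // ∃ k, r < ∑ i, sgn (σ i) * -g k i} := mod_cast h3
  linarith

/-! ### Chebyshev's inequality and symmetrization -/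

/-- Chebyshev's inequality for the centred empirical average. -/
lemma pi_abs_centeredAvg_ge_le {𝒵 : Type*} [MeasurableSpace 𝒵] {n : ℕ} (hn : 0 < n)
    (P : Measure 𝒵) [IsProbabilityMeasure P] {f : 𝒵 → ℝ} (hf : MemLp f 2 P) {v r : ℝ}
    (hr : 0 < r) (hv : ∫ z, f z ^ 2 ∂P ≤ v) :
    Measure.pi (fun _ : Fin n => P) {w | r ≤ |centeredAvg P w f|} ≤
      ENNReal.ofReal (v / (n * r ^ 2)) := by
  set Q := Measure.pi (fun _ : Fin n => P)
  have hn' : (0 : ℝ) < n := Nat.cast_pos.2 hn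
  have hfi (i : Fin n) : MemLp (fun w : Fin n → 𝒵 => f (w i)) 2 Q :=
    hf.comp_measurePreserving (measurePreserving_eval (fun _ : Fin n => P) i)
  have hS : MemLp (∑ i, fun w : Fin n → 𝒵 => f (w i)) 2 Q := memLp_finsetSum' _ fun i _ => hfi i
  have hmean : Q[∑ i, fun w : Fin n → 𝒵 => f (w i)] = n * ∫ z, f z ∂P := by
    have h1 (i : Fin n) : ∫ w, f (w i) ∂Q = ∫ z, f z ∂P := by
      have hmp := measurePreserving_eval (fun _ : Fin n => P) i
      rw [← hmp.map_eq, integral_map hmp.measurable.aemeasurable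
        (by rw [hmp.map_eq]; exact hf.aestronglyMeasurable)]
    simp only [Finset.sum_apply]
    rw [integral_finsetSum _ fun i _ => (hfi i).integrable (by norm_num)]
    simp [h1]
  have hvar : Var[∑ i, fun w : Fin n → 𝒵 => f (w i); Q] ≤ n * v := by
    rw [variance_sum_pi (fun _ => hf)]
    have : Var[f; P] ≤ v :=
      (variance_le_expectation_sq hf.aestronglyMeasurable).trans (by simpa using hv)
    simp only [Finset.sum_const, Finset.card_univ, Fintype.card_fin, nsmul_eq_mul]
    gcongr
  have hc := meas_ge_le_variance_div_sq hS (c := n * r) (by positivity)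
  rw [hmean] at hc
  refine (measure_mono fun w hw => ?_).trans (hc.trans (ENNReal.ofReal_le_ofReal ?_))
  · have h : (n : ℝ) * centeredAvg P w f = ∑ i, f (w i) - n * ∫ z, f z ∂P := by
      rw [centeredAvg]; field_simp
    simp only [Set.mem_ofPred_eq, Finset.sum_apply, ← h, abs_mul, Nat.abs_cast] at hw ⊢
    gcongr
  · calc _ ≤ n * v / (n * r) ^ 2 := by gcongr
      _ = _ := by field_simp

/-- Exchanging the two coordinates of a pair according to a sign. -/
def signSwap {𝒵 : Type*} (b : Bool) (z : 𝒵 × 𝒵) : 𝒵 × 𝒵 := if b then z else z.swap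

lemma measurePreserving_signSwap {𝒵 : Type*} [MeasurableSpace 𝒵] (P : Measure 𝒵)
    [SigmaFinite P] (b : Bool) : MeasurePreserving (signSwap b) (P.prod P) (P.prod P) := by
  cases b
  · exact Measure.measurePreserving_swap
  · exact MeasurePreserving.id _

/-- **Symmetrization in probability**. If each centred average is below `t / 2` with probability at
least `3 / 4`, a large supremum over the family forces, with that conditional probability, a large
difference from the averages over an independent copy of the sample. That difference is invariant in
law under random exchanges of coordinates. The factor `2` counts the two copies, and the bound `q`
on the conditional Rademacher probabilities is only required for samples in `G`. -/
lemma symmetrization {κ 𝒵 : Type*} [Finite κ] [MeasurableSpace 𝒵] {n : ℕ} (hn : 0 < n)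
    (P : Measure 𝒵) [IsProbabilityMeasure P] (f : κ → 𝒵 → ℝ) (hf : ∀ k, Measurable (f k))
    {t q : ℝ} (hq0 : 0 ≤ q)
    (hcheb : ∀ k, Measure.pi (fun _ : Fin n => P) {w | t / 2 ≤ |centeredAvg P w (f k)|} ≤
      ENNReal.ofReal (1 / 4))
    {G : Set (Fin n → 𝒵)} (hG : MeasurableSet G)
    (hq : ∀ w ∈ G, (Nat.card {σ : Fin n → Bool // ∃ k, n * t / 4 < |∑ i, sgn (σ i) * f k (w i)|}
      : ℝ) ≤ 2 ^ n * q) :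
    3 / 4 * (Measure.pi fun _ : Fin n => P).real {w | ∃ k, t < |centeredAvg P w (f k)|} ≤
      2 * (q + (Measure.pi fun _ : Fin n => P).real Gᶜ) := by
  classical
  set Q := Measure.pi (fun _ : Fin n => P)
  have hn' : (0 : ℝ) < n := Nat.cast_pos.2 hn
  have hcm (k) : Measurable fun w : Fin n → 𝒵 => centeredAvg P w (f k) := by
    have := hf k
    unfold centeredAvg; fun_prop
  set Z : Set (Fin n → 𝒵) := {w | ∃ k, t < |centeredAvg P w (f k)|} with hZ
  have hZm : MeasurableSet Z := by
    rw [hZ, Set.ofPred_exists]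
    exact MeasurableSet.iUnion fun k => measurableSet_lt measurable_const (hcm k).abs
  -- deviations of the difference of the two empirical averages
  set A : Set ((Fin n → 𝒵) × (Fin n → 𝒵)) :=
    {w | ∃ k, n * t / 2 < |∑ i, (f k (w.1 i) - f k (w.2 i))|} with hA
  have hAm : MeasurableSet A := by
    rw [hA, Set.ofPred_exists]
    refine MeasurableSet.iUnion fun k => measurableSet_lt measurable_const (Measurable.abs ?_)
    have := hf k
    fun_prop
  have hdiff (k) (w w' : Fin n → 𝒵) : ∑ i, (f k (w i) - f k (w' i)) =
      n * (centeredAvg P w (f k) - centeredAvg P w' (f k)) := by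
    rw [Finset.sum_sub_distrib, centeredAvg, centeredAvg]; field_simp; ring
  have hlow : 3 / 4 * Q.real Z ≤ (Q.prod Q).real A := by
    have h1 : ENNReal.ofReal (3 / 4) * Q Z ≤ (Q.prod Q) A := by
      rw [Measure.prod_apply hAm, ← setLIntegral_const]
      refine (setLIntegral_mono' hZm fun w hw => ?_).trans (setLIntegral_le_lintegral _ _)
      obtain ⟨k, hk⟩ := hw
      set C : Set (Fin n → 𝒵) := {w | t / 2 ≤ |centeredAvg P w (f k)|}
      have hCm : MeasurableSet C := measurableSet_le measurable_const (hcm k).abs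
      have hC : Q.real Cᶜ ≥ 3 / 4 := by
        have : Q.real C ≤ 1 / 4 := ENNReal.toReal_le_of_le_ofReal (by norm_num) (hcheb k)
        rw [probReal_compl_eq_one_sub hCm]; linarith
      rw [ENNReal.ofReal_le_iff_le_toReal (measure_ne_top _ _)]
      refine hC.trans (measureReal_mono fun w' hw' => ⟨k, ?_⟩)
      have hw'' : |centeredAvg P w' (f k)| < t / 2 := not_le.1 hw'
      rw [hdiff, abs_mul, Nat.abs_cast, mul_div_assoc]
      gcongr
      linarith [abs_sub_abs_le_abs_sub (centeredAvg P w (f k)) (centeredAvg P w' (f k))]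
    have h2 := ENNReal.toReal_mono (measure_ne_top _ _) h1
    rwa [ENNReal.toReal_mul, ENNReal.toReal_ofReal (by norm_num)] at h2
  -- deviations of the signed sums
  set H : (Fin n → Bool) → Set (Fin n → 𝒵) :=
    fun σ => {w | ∃ k, n * t / 4 < |∑ i, sgn (σ i) * f k (w i)|} with hH
  have hHm (σ) : MeasurableSet (H σ) := by
    rw [hH]; simp only [Set.ofPred_exists]
    refine MeasurableSet.iUnion fun k => measurableSet_lt measurable_const (Measurable.abs ?_)
    have := hf k
    fun_prop
  have hsym (σ) : (Q.prod Q).real A ≤ 2 * Q.real (H σ) := by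
    set M := Measure.pi (fun _ : Fin n => P.prod P)
    have hmp : MeasurePreserving (MeasurableEquiv.arrowProdEquivProdArrow 𝒵 𝒵 (Fin n)) M
        (Q.prod Q) := measurePreserving_arrowProdEquivProdArrow 𝒵 𝒵 (Fin n) _ _
    have hsw : MeasurePreserving (fun (z : Fin n → 𝒵 × 𝒵) i => signSwap (σ i) (z i)) M M :=
      measurePreserving_pi _ _ fun i => measurePreserving_signSwap P (σ i)
    rw [← (hmp.comp hsw).measureReal_preimage hAm.nullMeasurableSet]
    have hfst : MeasurePreserving (fun (z : Fin n → 𝒵 × 𝒵) i => (z i).1) M Q :=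
      measurePreserving_fst.comp hmp
    have hsnd : MeasurePreserving (fun (z : Fin n → 𝒵 × 𝒵) i => (z i).2) M Q :=
      measurePreserving_snd.comp hmp
    rw [two_mul]
    nth_rewrite 1 [← hfst.measureReal_preimage (hHm σ).nullMeasurableSet]
    rw [← hsnd.measureReal_preimage (hHm σ).nullMeasurableSet]
    refine (measureReal_mono (fun z hz => ?_)).trans (measureReal_union_le _ _)
    obtain ⟨k, hk⟩ := hz
    have hs (i) : f k (signSwap (σ i) (z i)).1 - f k (signSwap (σ i) (z i)).2 =
        sgn (σ i) * f k (z i).1 - sgn (σ i) * f k (z i).2 := by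
      cases σ i <;> simp [signSwap, neg_add_eq_sub]
    have hk' : n * t / 2 <
        |∑ i, sgn (σ i) * f k (z i).1 - ∑ i, sgn (σ i) * f k (z i).2| := by
      rw [← Finset.sum_sub_distrib, ← Finset.sum_congr rfl fun i _ => hs i]
      exact hk
    by_contra hcon
    simp only [Set.mem_union, not_or] at hcon
    have c1 : |∑ i, sgn (σ i) * f k (z i).1| ≤ n * t / 4 := not_lt.1 fun h => hcon.1 ⟨k, h⟩
    have c2 : |∑ i, sgn (σ i) * f k (z i).2| ≤ n * t / 4 := not_lt.1 fun h => hcon.2 ⟨k, h⟩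
    linarith [abs_sub (∑ i, sgn (σ i) * f k (z i).1) (∑ i, sgn (σ i) * f k (z i).2)]
  -- averaging over the signs
  have havg : ∑ σ, Q.real (H σ) ≤ 2 ^ n * (q + Q.real Gᶜ) := by
    have h1 (σ) : Q.real (H σ) ≤ Q.real (H σ ∩ G) + Q.real Gᶜ := by
      refine (measureReal_mono (fun w hw => ?_)).trans (measureReal_union_le _ _)
      by_cases h : w ∈ G
      · exact Or.inl ⟨hw, h⟩
      · exact Or.inr h
    have hcount : ∑ σ, Q.real (H σ ∩ G) ≤ 2 ^ n * q := by
      have h2 (σ) : Q.real (H σ ∩ G) = ∫ w, (H σ ∩ G).indicator 1 w ∂Q := by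
        rw [integral_indicator_one ((hHm σ).inter hG)]
      have hint (σ) : Integrable ((H σ ∩ G).indicator (1 : (Fin n → 𝒵) → ℝ)) Q :=
        (integrable_const (1 : ℝ)).indicator ((hHm σ).inter hG)
      simp only [h2]
      rw [← integral_finsetSum _ fun σ _ => hint σ]
      calc _ ≤ ∫ _, 2 ^ n * q ∂Q := by
            refine integral_mono
              (integrable_finsetSum _ fun σ _ => hint σ) (integrable_const _) fun w => ?_
            by_cases hw : w ∈ G
            · refine le_trans (le_of_eq ?_) (hq w hw)
              rw [Nat.card_eq_fintype_card, Fintype.card_subtype, Finset.card_filter]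
              push_cast
              refine Finset.sum_congr rfl fun σ _ => ?_
              simp [Set.indicator_apply, hw, hH]
            · simpa [Set.indicator_apply, hw] using hq0
        _ = _ := by simp
    calc ∑ σ, Q.real (H σ) ≤ ∑ σ, (Q.real (H σ ∩ G) + Q.real Gᶜ) :=
          Finset.sum_le_sum fun σ _ => h1 σ
      _ = ∑ σ, Q.real (H σ ∩ G) + 2 ^ n * Q.real Gᶜ := by
          rw [Finset.sum_add_distrib]; simp
      _ ≤ _ := by rw [mul_add]; gcongr
  have hfin : ∑ _σ : Fin n → Bool, (Q.prod Q).real A ≤ ∑ σ, 2 * Q.real (H σ) :=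
    Finset.sum_le_sum fun σ _ => hsym σ
  rw [← Finset.mul_sum] at hfin
  simp only [Finset.sum_const, Finset.card_univ, Fintype.card_pi, Fintype.card_bool,
    Finset.prod_const, Fintype.card_fin, nsmul_eq_mul, Nat.cast_pow, Nat.cast_ofNat] at hfin
  have hpow : (0 : ℝ) < 2 ^ n := by positivity
  refine hlow.trans (le_of_mul_le_mul_left (a := (2 : ℝ) ^ n) ?_ hpow)
  linarith

/-! ### Regular samples and the conditional deviation bound -/

/-- The index set of the supremum defining `empiricalError`. -/
def localSet {p : ℕ} (Θ : Set (Fin p → ℝ)) (θ₀ : Fin p → ℝ) (c u : ℝ) : Set (Fin p → ℝ) :=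
  {δ | δ ∈ restrictedSet Θ θ₀ c ∧ l2Norm δ ≤ u}

lemma l1Norm_eq_sum {p : ℕ} (δ : Fin p → ℝ) : l1Norm δ = ∑ j, |δ j| := by
  simp [l1Norm, PiLp.norm_eq_of_L1]

lemma l2Norm_sq {p : ℕ} (δ : Fin p → ℝ) : l2Norm δ ^ 2 = ∑ j, δ j ^ 2 := by
  simp [l2Norm, EuclideanSpace.norm_sq_eq]

/-- On the restricted cone the `ℓ¹` norm is controlled by the `ℓ²` norm. -/
lemma sum_abs_le_of_mem_localSet {p : ℕ} {Θ : Set (Fin p → ℝ)} {θ₀ δ : Fin p → ℝ} {c u : ℝ}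
    (hc : 0 ≤ c) (hδ : δ ∈ localSet Θ θ₀ c u) :
    ∑ j, |δ j| ≤ (1 + c) * √(sparsity θ₀) * u := by
  classical
  obtain ⟨⟨hcone, -⟩, hu⟩ := hδ
  set T : Finset (Fin p) := Finset.univ.filter fun j => θ₀ j ≠ 0 with hT
  have hcard : (sparsity θ₀ : ℝ) = T.card := by
    rw [sparsity, activeSet, ← Set.ncard_coe_finset]; simp [hT]
  have h1 : l1Norm (restrictTo (activeSet θ₀) δ) = ∑ j ∈ T, |δ j| := by
    rw [l1Norm_eq_sum, hT, Finset.sum_filter]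
    refine Finset.sum_congr rfl fun j _ => ?_
    by_cases h : θ₀ j = 0 <;> simp [restrictTo, activeSet, h]
  have h2 : l1Norm (restrictTo (activeSet θ₀)ᶜ δ) + ∑ j ∈ T, |δ j| = ∑ j, |δ j| := by
    rw [l1Norm_eq_sum, hT, Finset.sum_filter, ← Finset.sum_add_distrib]
    refine Finset.sum_congr rfl fun j _ => ?_
    by_cases h : θ₀ j = 0 <;> simp [restrictTo, activeSet, h]
  have hu0 : 0 ≤ l2Norm δ := norm_nonneg _
  have h3 : ∑ j ∈ T, |δ j| ≤ √(sparsity θ₀) * u := by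
    refine le_trans (abs_le_of_sq_le_sq' ?_ (by positivity)).2
      (mul_le_mul_of_nonneg_left hu (Real.sqrt_nonneg _))
    rw [mul_pow, Real.sq_sqrt (Nat.cast_nonneg _), hcard, l2Norm_sq]
    refine sq_sum_le_card_mul_sum_sq.trans ?_
    gcongr
    simp only [sq_abs]
    exact Finset.sum_le_sum_of_subset_of_nonneg (Finset.subset_univ _) fun _ _ _ => sq_nonneg _
  rw [h1] at hcone
  calc ∑ j, |δ j| ≤ (1 + c) * ∑ j ∈ T, |δ j| := by linarith
    _ ≤ (1 + c) * (√(sparsity θ₀) * u) := by gcongr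
    _ = _ := by ring

lemma abs_dotProduct_le {p : ℕ} (x δ : Fin p → ℝ) : |x ⬝ᵥ δ| ≤ ‖x‖ * ∑ j, |δ j| := by
  rw [dotProduct, Finset.mul_sum]
  refine (Finset.abs_sum_le_sum_abs _ _).trans (Finset.sum_le_sum fun j _ => ?_)
  rw [abs_mul]
  exact mul_le_mul_of_nonneg_right (norm_le_pi_norm x j) (abs_nonneg _)

lemma measurable_lossDiff {p : ℕ} {𝒴 : Type*} [MeasurableSpace 𝒴] {m : ℝ → 𝒴 → ℝ}
    (hm : Measurable (Function.uncurry m)) (θ₀ θ : Fin p → ℝ) :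
    Measurable (lossDiff m θ₀ θ) := by
  have h (θ : Fin p → ℝ) : Measurable fun w : (Fin p → ℝ) × 𝒴 => m (w.1 ⬝ᵥ θ) w.2 := by
    have h1 : Measurable fun w : (Fin p → ℝ) × 𝒴 => (w.1 ⬝ᵥ θ, w.2) := by
      unfold dotProduct; fun_prop
    exact hm.comp h1
  exact (h θ).sub (h θ₀)

lemma memLp_two_and_integral_sq_le {𝒵 : Type*} [MeasurableSpace 𝒵] {P : Measure 𝒵}
    {f : 𝒵 → ℝ} (hf : Measurable f) {v : ℝ} (hv : 0 ≤ v)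
    (h : ∫⁻ z, ENNReal.ofReal (f z ^ 2) ∂P ≤ ENNReal.ofReal v) :
    MemLp f 2 P ∧ ∫ z, f z ^ 2 ∂P ≤ v := by
  constructor
  · rw [memLp_two_iff_integrable_sq hf.aestronglyMeasurable]
    refine ⟨(hf.pow_const 2).aestronglyMeasurable, ?_⟩
    rw [hasFiniteIntegral_iff_ofReal (ae_of_all _ fun z => sq_nonneg _)]
    exact h.trans_lt ENNReal.ofReal_lt_top
  · rw [integral_eq_lintegral_of_nonneg_ae (ae_of_all _ fun z => sq_nonneg _)
      (hf.pow_const 2).aestronglyMeasurable]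
    exact ENNReal.toReal_le_of_le_ofReal hv h

/-- The samples for which the Rademacher process of the loss differences is under control: the
points lie in `𝒲` and satisfy the bounds on the covariates and on the fourth empirical moment of
the Lipschitz constants. -/
def regularSamples {p : ℕ} {𝒴 : Type*} (n : ℕ) (𝒲 : Set ((Fin p → ℝ) × 𝒴))
    (L : (Fin p → ℝ) × 𝒴 → ℝ≥0) (B C_X C_L : ℝ) : Set (Fin n → (Fin p → ℝ) × 𝒴) :=
  {w | ∀ i, w i ∈ 𝒲} ∩ {w | ∀ i, ‖(w i).1‖ ≤ B} ∩ {w | ∀ j, ∑ i, (w i).1 j ^ 4 ≤ n * C_X ^ 4} ∩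
    {w | ∑ i, (L (w i) : ℝ) ^ 4 ≤ 2 * n * (C_L / 2) ^ 4}

section

variable {p : ℕ} {𝒴 : Type*} [MeasurableSpace 𝒴]

lemma measurableSet_forall_mem {n : ℕ} {𝒲 : Set ((Fin p → ℝ) × 𝒴)} (h𝒲 : MeasurableSet 𝒲) :
    MeasurableSet {w : Fin n → (Fin p → ℝ) × 𝒴 | ∀ i, w i ∈ 𝒲} := by
  rw [Set.ofPred_forall]
  exact MeasurableSet.iInter fun i => measurable_pi_apply i h𝒲

lemma measurableSet_forall_norm_le {n : ℕ} (B : ℝ) :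
    MeasurableSet {w : Fin n → (Fin p → ℝ) × 𝒴 | ∀ i, ‖(w i).1‖ ≤ B} := by
  rw [Set.ofPred_forall]
  exact MeasurableSet.iInter fun i => measurableSet_le (by fun_prop) measurable_const

lemma measurableSet_forall_sum_pow_le {n : ℕ} (C : ℝ) :
    MeasurableSet {w : Fin n → (Fin p → ℝ) × 𝒴 | ∀ j, ∑ i, (w i).1 j ^ 4 ≤ C} := by
  rw [Set.ofPred_forall]
  exact MeasurableSet.iInter fun i => measurableSet_le (by fun_prop) measurable_const

lemma measurableSet_sum_lipschitz_le {n : ℕ} {L : (Fin p → ℝ) × 𝒴 → ℝ≥0} (hL : Measurable L)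
    (C : ℝ) : MeasurableSet {w : Fin n → (Fin p → ℝ) × 𝒴 | ∑ i, (L (w i) : ℝ) ^ 4 ≤ C} :=
  measurableSet_le (by fun_prop) measurable_const

lemma measurableSet_regularSamples {n : ℕ} {𝒲 : Set ((Fin p → ℝ) × 𝒴)} (h𝒲 : MeasurableSet 𝒲)
    {L : (Fin p → ℝ) × 𝒴 → ℝ≥0} (hL : Measurable L) (B C_X C_L : ℝ) :
    MeasurableSet (regularSamples n 𝒲 L B C_X C_L) :=
  (((measurableSet_forall_mem h𝒲).inter (measurableSet_forall_norm_le B)).inter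
    (measurableSet_forall_sum_pow_le _)).inter (measurableSet_sum_lipschitz_le hL _)

/-- The law of an i.i.d. sample is the product measure. -/
lemma IsIIDSample.measurePreserving {Ω 𝒵 : Type*} [MeasurableSpace Ω] [MeasurableSpace 𝒵] {n : ℕ}
    {μ : Measure Ω} [IsProbabilityMeasure μ] {P : Measure 𝒵} {W : Fin n → Ω → 𝒵}
    (hW : IsIIDSample μ P W) :
    MeasurePreserving (fun ω i => W i ω) μ (Measure.pi fun _ => P) := by
  refine ⟨measurable_pi_lambda _ hW.measurable, ?_⟩
  rw [(iIndepFun_iff_map_fun_eq_pi_map fun i => (hW.measurable i).aemeasurable).1 hW.indep]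
  simp only [hW.law]

lemma WithProbAtLeast.real_compl_le {Ω 𝒵 : Type*} [MeasurableSpace Ω] [MeasurableSpace 𝒵]
    {μ : Measure Ω} [IsProbabilityMeasure μ] {Q : Measure 𝒵} [IsProbabilityMeasure Q]
    {X : Ω → 𝒵} (hX : MeasurePreserving X μ Q) {E : Set 𝒵} (hE : MeasurableSet E) {ζ : ℝ}
    (h : WithProbAtLeast μ (1 - ζ) (X ⁻¹' E)) : Q.real Eᶜ ≤ ζ := by
  obtain ⟨A, -, hAE, hA⟩ := h
  have h1 := hA.trans (measureReal_mono hAE)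
  rw [hX.measureReal_preimage hE.nullMeasurableSet] at h1
  rw [probReal_compl_eq_one_sub hE]
  linarith

/-- The fourth empirical moment of the Lipschitz constants is controlled by Chebyshev's
inequality, through their eighth moment. -/
lemma pi_real_sum_lipschitz_compl_le {n : ℕ} (hn : 0 < n) (P : Measure ((Fin p → ℝ) × 𝒴))
    [IsProbabilityMeasure P] {L : (Fin p → ℝ) × 𝒴 → ℝ≥0} (hL : Measurable L) {C_L : ℝ}
    (hC : 0 < C_L) (hmom : ∫⁻ w, (L w : ℝ≥0∞) ^ 8 ∂P ≤ ENNReal.ofReal ((C_L / 2) ^ 8)) :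
    (Measure.pi fun _ : Fin n => P).real
      {w | ∑ i, (L (w i) : ℝ) ^ 4 ≤ 2 * n * (C_L / 2) ^ 4}ᶜ ≤ 1 / n := by
  have hn' : (0 : ℝ) < n := Nat.cast_pos.2 hn
  have hgm : Measurable fun w => (L w : ℝ) ^ 4 := by fun_prop
  obtain ⟨hg, hsq⟩ := memLp_two_and_integral_sq_le (P := P) hgm (v := (C_L / 2) ^ 8)
    (by positivity) (by
      refine le_trans (le_of_eq (lintegral_congr fun w => ?_)) hmom
      rw [← pow_mul, ENNReal.ofReal_pow (by positivity), ENNReal.ofReal_coe_nnreal])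
  have hmean : ∫ w, (L w : ℝ) ^ 4 ∂P ≤ (C_L / 2) ^ 4 := by
    have h1 := variance_nonneg (fun w => (L w : ℝ) ^ 4) P
    rw [variance_eq_sub hg] at h1
    simp only [Pi.pow_apply] at h1
    refine (abs_le_of_sq_le_sq' ?_ (by positivity)).2
    rw [← pow_mul]
    linarith
  have hc := pi_abs_centeredAvg_ge_le hn P hg (r := (C_L / 2) ^ 4) (by positivity) hsq
  rw [show (C_L / 2) ^ 8 / (n * ((C_L / 2) ^ 4) ^ 2) = 1 / n by field_simp] at hc
  refine ENNReal.toReal_le_of_le_ofReal (by positivity) ((measure_mono fun w hw => ?_).trans hc)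
  have hw' : 2 * n * (C_L / 2) ^ 4 < ∑ i, (L (w i) : ℝ) ^ 4 := not_le.1 hw
  have : 2 * (C_L / 2) ^ 4 ≤ (n : ℝ)⁻¹ * ∑ i, (L (w i) : ℝ) ^ 4 := by
    rw [inv_mul_eq_div, le_div_iff₀ hn']; linarith
  have habs := le_abs_self (centeredAvg P w fun w => (L w : ℝ) ^ 4)
  rw [Set.mem_ofPred_eq]
  refine le_trans ?_ habs
  rw [centeredAvg]
  linarith

lemma pi_real_forall_mem_compl_eq_zero {𝒵 : Type*} [MeasurableSpace 𝒵] {n : ℕ} {P : Measure 𝒵}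
    [IsProbabilityMeasure P] {𝒲 : Set 𝒵} (h𝒲 : ∀ᵐ w ∂P, w ∈ 𝒲) :
    (Measure.pi fun _ : Fin n => P).real {w | ∀ i, w i ∈ 𝒲}ᶜ = 0 := by
  have : ∀ᵐ w ∂(Measure.pi fun _ : Fin n => P), ∀ i, w i ∈ 𝒲 := ae_all_iff.2 fun i =>
    (measurePreserving_eval (fun _ : Fin n => P) i).quasiMeasurePreserving.ae h𝒲
  rw [measureReal_def, mem_ae_iff.1 this, ENNReal.toReal_zero]

lemma pi_real_regularSamples_compl_le {Ω : Type*} [MeasurableSpace Ω] {n : ℕ} (hn : 0 < n)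
    {μ : Measure Ω} [IsProbabilityMeasure μ] {P : Measure ((Fin p → ℝ) × 𝒴)}
    [IsProbabilityMeasure P] {𝒲 : Set ((Fin p → ℝ) × 𝒴)} (h𝒲 : ∀ᵐ w ∂P, w ∈ 𝒲)
    {W : Fin n → Ω → (Fin p → ℝ) × 𝒴} (hW : IsIIDSample μ P W) {ζ B C_X : ℝ}
    (hX : CovariateCondition μ W ζ B C_X) {L : (Fin p → ℝ) × 𝒴 → ℝ≥0} (hL : Measurable L)
    {C_L : ℝ} (hC : 0 < C_L)
    (hmom : ∫⁻ w, (L w : ℝ≥0∞) ^ 8 ∂P ≤ ENNReal.ofReal ((C_L / 2) ^ 8)) :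
    (Measure.pi fun _ : Fin n => P).real (regularSamples n 𝒲 L B C_X C_L)ᶜ ≤ 2 * ζ + 1 / n := by
  set Q := Measure.pi fun _ : Fin n => P
  have h0 : Q.real {w | ∀ i, w i ∈ 𝒲}ᶜ = 0 := pi_real_forall_mem_compl_eq_zero h𝒲
  have h1 := WithProbAtLeast.real_compl_le hW.measurePreserving (measurableSet_forall_norm_le B)
    hX.bounded
  have h2 := WithProbAtLeast.real_compl_le hW.measurePreserving
    (measurableSet_forall_sum_pow_le (n * C_X ^ 4)) hX.moment
  have h3 := pi_real_sum_lipschitz_compl_le hn P hL hC hmom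
  rw [regularSamples, Set.compl_inter, Set.compl_inter, Set.compl_inter]
  refine (measureReal_union_le _ _).trans ?_
  have h4 := measureReal_union_le (μ := Q) ({w | ∀ i, w i ∈ 𝒲}ᶜ ∪ {w | ∀ i, ‖(w i).1‖ ≤ B}ᶜ)
    {w | ∀ j, ∑ i, (w i).1 j ^ 4 ≤ n * C_X ^ 4}ᶜ
  have h5 := measureReal_union_le (μ := Q) {w | ∀ i, w i ∈ 𝒲}ᶜ {w | ∀ i, ‖(w i).1‖ ≤ B}ᶜ
  linarith

/-- Loss differences inherit the Lipschitz property of the loss, for bounded covariates. -/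
lemma abs_lossDiff_sub_le {P : Measure ((Fin p → ℝ) × 𝒴)} {𝒲 : Set ((Fin p → ℝ) × 𝒴)}
    {m : ℝ → 𝒴 → ℝ} {Θ : Set (Fin p → ℝ)} {θ₀ : Fin p → ℝ} {L : (Fin p → ℝ) × 𝒴 → ℝ≥0}
    {c_L C_L : ℝ} (hL : LocalLossCondition P 𝒲 m Θ θ₀ L c_L C_L) {w : (Fin p → ℝ) × 𝒴}
    (hw : w ∈ 𝒲) {δ δ' : Fin p → ℝ} (h : |w.1 ⬝ᵥ δ| ≤ c_L) (h' : |w.1 ⬝ᵥ δ'| ≤ c_L) :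
    |lossDiff m θ₀ (θ₀ + δ) w - lossDiff m θ₀ (θ₀ + δ') w| ≤ L w * |w.1 ⬝ᵥ δ - w.1 ⬝ᵥ δ'| := by
  have := hL.lipschitz w hw _ _ (max_le h h')
  simpa [lossDiff, dotProduct_add] using this

lemma abs_lossDiff_le {P : Measure ((Fin p → ℝ) × 𝒴)} {𝒲 : Set ((Fin p → ℝ) × 𝒴)}
    {m : ℝ → 𝒴 → ℝ} {Θ : Set (Fin p → ℝ)} {θ₀ : Fin p → ℝ} {L : (Fin p → ℝ) × 𝒴 → ℝ≥0}
    {c_L C_L : ℝ} (hL : LocalLossCondition P 𝒲 m Θ θ₀ L c_L C_L) {w : (Fin p → ℝ) × 𝒴}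
    (hw : w ∈ 𝒲) {δ : Fin p → ℝ} (h : |w.1 ⬝ᵥ δ| ≤ c_L) :
    |lossDiff m θ₀ (θ₀ + δ) w| ≤ L w * |w.1 ⬝ᵥ δ| := by
  have := abs_lossDiff_sub_le hL hw h (δ' := 0) (by simpa using hL.c_L_pos.le)
  simpa [lossDiff] using this

/-- Conditional deviation bound for the Rademacher process, given a regular sample. -/
lemma card_signs_lossDiff_le {κ : Type*} [Finite κ] {n : ℕ} (hn : 0 < n) (hp : 0 < p)
    {P : Measure ((Fin p → ℝ) × 𝒴)} {𝒲 : Set ((Fin p → ℝ) × 𝒴)}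
    {m : ℝ → 𝒴 → ℝ} {Θ : Set (Fin p → ℝ)} {θ₀ : Fin p → ℝ} {L : (Fin p → ℝ) × 𝒴 → ℝ≥0}
    {c_L C_L B C_X R r : ℝ} (hL : LocalLossCondition P 𝒲 m Θ θ₀ L c_L C_L) (hB : 0 ≤ B)
    (hCX : 0 < C_X) (hR : 0 < R) (hr : 0 < r) (hBR : B * R ≤ c_L) (δ : κ → Fin p → ℝ)
    (hδ : ∀ k, ∑ j, |δ k j| ≤ R) {w : Fin n → (Fin p → ℝ) × 𝒴}
    (hw : w ∈ regularSamples n 𝒲 L B C_X C_L) :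
    (Nat.card {σ : Fin n → Bool //
      ∃ k, r < |∑ i, sgn (σ i) * lossDiff m θ₀ (θ₀ + δ k) (w i)|} : ℝ) ≤
      2 ^ n * (4 * p * Real.exp (-(r ^ 2 / (2 * R ^ 2 * (n * C_L ^ 2 * C_X ^ 2 / 2))))) := by
  have hn' : (0 : ℝ) < n := Nat.cast_pos.2 hn
  have hCL := hL.C_L_pos
  obtain ⟨⟨⟨h𝒲, hbd⟩, hX4⟩, hL4⟩ := hw
  simp only [Set.mem_ofPred_eq] at h𝒲 hbd hX4 hL4
  have hdot (k i) : |(w i).1 ⬝ᵥ δ k| ≤ c_L :=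
    ((abs_dotProduct_le _ _).trans (mul_le_mul (hbd i) (hδ k)
      (Finset.sum_nonneg fun _ _ => abs_nonneg _) hB)).trans hBR
  have hsmul (i) (d : Fin p → ℝ) :
      (fun j => (L (w i) : ℝ) * (w i).1 j) ⬝ᵥ d = L (w i) * ((w i).1 ⬝ᵥ d) := by
    simp only [dotProduct, Finset.mul_sum, mul_assoc]
  refine card_signs_abs_lt_le _ (fun i j => L (w i) * (w i).1 j) δ hp hR (by positivity) hr
    (fun k i => ?_) (fun k l i => ?_) hδ fun j => ?_
  · rw [hsmul, abs_mul, NNReal.abs_eq]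
    exact abs_lossDiff_le hL (h𝒲 i) (hdot k i)
  · rw [hsmul, hsmul, ← mul_sub, abs_mul, NNReal.abs_eq]
    exact abs_lossDiff_sub_le hL (h𝒲 i) (hdot k i) (hdot l i)
  · refine (abs_le_of_sq_le_sq' ?_ (by positivity)).2
    calc (∑ i, ((L (w i) : ℝ) * (w i).1 j) ^ 2) ^ 2
        = (∑ i, (L (w i) : ℝ) ^ 2 * (w i).1 j ^ 2) ^ 2 := by simp only [mul_pow]
      _ ≤ (∑ i, ((L (w i) : ℝ) ^ 2) ^ 2) * ∑ i, ((w i).1 j ^ 2) ^ 2 :=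
          Finset.sum_mul_sq_le_sq_mul_sq _ _ _
      _ ≤ (2 * n * (C_L / 2) ^ 4) * (n * C_X ^ 4) := by
          simp only [← pow_mul]
          exact mul_le_mul hL4 (hX4 j) (Finset.sum_nonneg fun _ _ => Even.pow_nonneg (by decide) _)
            (by positivity)
      _ = (n * C_L ^ 2 * C_X ^ 2) ^ 2 / 8 := by ring
      _ ≤ _ := by nlinarith [sq_nonneg (n * C_L ^ 2 * C_X ^ 2)]

/-- The Gaussian tail at the deviation level of the theorem is negligible. -/
lemma tail_le {n p : ℕ} (hn : 3 ≤ n) (hp : 2 ≤ p) {a : ℝ} (ha : a = 32 * Real.log (p * n)) :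
    4 * p * Real.exp (-a) ≤ 1 / (9 * n) := by
  have hn' : (3 : ℝ) ≤ n := mod_cast hn
  have hp' : (2 : ℝ) ≤ p := mod_cast hp
  have hpn : (0 : ℝ) < p * n := by positivity
  have h1 : Real.exp (-a) ≤ ((p * n : ℝ) ^ 3)⁻¹ := by
    have hlog : 0 ≤ Real.log (p * n) := Real.log_nonneg (by nlinarith)
    rw [← Real.exp_log (pow_pos hpn 3), ← Real.exp_neg, Real.log_pow]
    exact Real.exp_le_exp.2 (by push_cast; linarith)
  calc 4 * p * Real.exp (-a) ≤ 4 * p * ((p * n : ℝ) ^ 3)⁻¹ := by gcongr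
    _ = 4 / (p ^ 2 * n ^ 2 * n) := by field_simp
    _ ≤ 4 / (2 ^ 2 * 3 ^ 2 * n) := by gcongr
    _ = _ := by field_simp; norm_num

/-- A countable subset of a set that is dense for the graph topology of an arbitrary function. -/
lemma exists_seq_dense_graph {α : Type*} [TopologicalSpace α] [SecondCountableTopology α]
    {s : Set α} (hs : s.Nonempty) (e : α → ℝ) :
    ∃ d : ℕ → α, (∀ k, d k ∈ s) ∧
      ∀ x ∈ s, (x, e x) ∈ closure (Set.range fun k => (d k, e (d k))) := by
  set S : Set (α × ℝ) := (fun x => (x, e x)) '' s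
  have : Nonempty S := (hs.image _).to_subtype
  have hd (k) : ∃ x ∈ s, (x, e x) = (TopologicalSpace.denseSeq S k : α × ℝ) :=
    (TopologicalSpace.denseSeq S k).2
  choose d hds hde using hd
  refine ⟨d, hds, fun x hx => ?_⟩
  have h1 : (⟨(x, e x), x, hx, rfl⟩ : S) ∈ closure (Set.range (TopologicalSpace.denseSeq S)) :=
    TopologicalSpace.denseRange_denseSeq S _
  have h2 := image_closure_subset_closure_image continuous_subtype_val
    (Set.mem_image_of_mem Subtype.val h1)
  rw [← Set.range_comp] at h2
  simpa only [hde, Function.comp_def] using h2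

end

/-! ### Deviation bounds for families of directions -/

section

variable {p : ℕ} {𝒴 : Type*} [MeasurableSpace 𝒴]

lemma lossDiff_memLp_and_integral_sq_le {P : Measure ((Fin p → ℝ) × 𝒴)}
    {𝒲 : Set ((Fin p → ℝ) × 𝒴)} {m : ℝ → 𝒴 → ℝ} (hm : Measurable (Function.uncurry m))
    {Θ : Set (Fin p → ℝ)} {θ₀ : Fin p → ℝ} {L : (Fin p → ℝ) × 𝒴 → ℝ≥0} {c_L C_L c u : ℝ}
    (hL : LocalLossCondition P 𝒲 m Θ θ₀ L c_L C_L) (hu : 0 ≤ u) (huc : u ≤ c_L)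
    {δ : Fin p → ℝ} (hδ : δ ∈ localSet Θ θ₀ c u) :
    MemLp (lossDiff m θ₀ (θ₀ + δ)) 2 P ∧
      ∫ w, lossDiff m θ₀ (θ₀ + δ) w ^ 2 ∂P ≤ C_L ^ 2 * u ^ 2 :=
  memLp_two_and_integral_sq_le (measurable_lossDiff hm _ _) (by positivity)
    (hL.meanSquare u ⟨hu, huc⟩ _ hδ.1.2 (by simpa using hδ.2))

/-- Deviation bound for the supremum over finitely many directions. -/
lemma pi_real_exists_lt_centeredAvg_le {κ : Type*} [Finite κ] {n : ℕ} (hn : 0 < n) (hp : 0 < p)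
    {P : Measure ((Fin p → ℝ) × 𝒴)} [IsProbabilityMeasure P] {𝒲 : Set ((Fin p → ℝ) × 𝒴)}
    (h𝒲 : MeasurableSet 𝒲) {m : ℝ → 𝒴 → ℝ} (hm : Measurable (Function.uncurry m))
    {Θ : Set (Fin p → ℝ)} {θ₀ : Fin p → ℝ} {L : (Fin p → ℝ) × 𝒴 → ℝ≥0}
    {c_L C_L B C_X R c u t : ℝ} (hL : LocalLossCondition P 𝒲 m Θ θ₀ L c_L C_L) (hB : 0 ≤ B)
    (hCX : 0 < C_X) (hR : 0 < R) (hBR : B * R ≤ c_L) (hu : 0 ≤ u) (huc : u ≤ c_L) (ht : 0 < t)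
    (hside : 16 * (C_L ^ 2 * u ^ 2) ≤ n * t ^ 2) (δ : κ → Fin p → ℝ)
    (hδ : ∀ k, δ k ∈ localSet Θ θ₀ c u) (hδR : ∀ k, ∑ j, |δ k j| ≤ R) :
    3 / 4 * (Measure.pi fun _ : Fin n => P).real
        {w | ∃ k, t < |centeredAvg P w (lossDiff m θ₀ (θ₀ + δ k))|} ≤
      2 * (4 * p * Real.exp (-((n * t / 4) ^ 2 / (2 * R ^ 2 * (n * C_L ^ 2 * C_X ^ 2 / 2)))) +
        (Measure.pi fun _ : Fin n => P).real (regularSamples n 𝒲 L B C_X C_L)ᶜ) := by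
  have hn' : (0 : ℝ) < n := Nat.cast_pos.2 hn
  refine symmetrization hn P (fun k => lossDiff m θ₀ (θ₀ + δ k))
    (fun k => measurable_lossDiff hm _ _) (by positivity) (fun k => ?_)
    (measurableSet_regularSamples h𝒲 hL.measurable_L B C_X C_L) fun w hw =>
      card_signs_lossDiff_le hn hp hL hB hCX hR (by positivity) hBR δ hδR hw
  obtain ⟨h1, h2⟩ := lossDiff_memLp_and_integral_sq_le hm hL hu huc (hδ k)
  refine (pi_abs_centeredAvg_ge_le hn P h1 (half_pos ht) h2).trans (ENNReal.ofReal_le_ofReal ?_)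
  rw [div_le_div_iff₀ (by positivity) (by norm_num)]
  linarith

/-- A deviation bound that holds uniformly for finite families holds for sequences. -/
lemma pi_real_exists_nat_le {𝒵 : Type*} [MeasurableSpace 𝒵] (Q : Measure 𝒵) [IsFiniteMeasure Q]
    (E : ℕ → Set 𝒵) {C : ℝ} (h : ∀ N, Q.real {w | ∃ k : Fin N, w ∈ E k} ≤ C) :
    Q.real {w | ∃ k, w ∈ E k} ≤ C := by
  have hU : {w | ∃ k, w ∈ E k} = ⋃ N, {w | ∃ k : Fin N, w ∈ E k} := by
    ext w
    simp only [Set.mem_ofPred_eq, Set.mem_iUnion]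
    exact ⟨fun ⟨k, hk⟩ => ⟨k + 1, ⟨k, k.lt_succ_self⟩, hk⟩, fun ⟨_, k, hk⟩ => ⟨k, hk⟩⟩
  have hmono : Monotone fun N => {w | ∃ k : Fin N, w ∈ E k} := fun N M hNM w ⟨k, hk⟩ =>
    ⟨Fin.castLE hNM k, hk⟩
  have hlim := (ENNReal.tendsto_toReal (measure_ne_top Q _)).comp
    (tendsto_measure_iUnion_atTop (μ := Q) hmono)
  rw [← hU] at hlim
  exact le_of_tendsto' hlim h

/-- For a sample with bounded covariates, a bound on the centred averages along a sequence that is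
dense for the graph topology of the expected loss difference extends to the whole local set. The
expected loss difference need not be continuous, whence the graph topology. -/
lemma abs_centeredAvg_le_of_dense {n : ℕ} {P : Measure ((Fin p → ℝ) × 𝒴)}
    {𝒲 : Set ((Fin p → ℝ) × 𝒴)} {m : ℝ → 𝒴 → ℝ} {Θ : Set (Fin p → ℝ)} {θ₀ : Fin p → ℝ}
    {L : (Fin p → ℝ) × 𝒴 → ℝ≥0} {c_L C_L t : ℝ} (hL : LocalLossCondition P 𝒲 m Θ θ₀ L c_L C_L)
    {w : Fin n → (Fin p → ℝ) × 𝒴} (hw : ∀ i, w i ∈ 𝒲) {d : ℕ → Fin p → ℝ}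
    (hd : ∀ k i, |(w i).1 ⬝ᵥ d k| ≤ c_L)
    (hdt : ∀ k, |centeredAvg P w (lossDiff m θ₀ (θ₀ + d k))| ≤ t) {δ : Fin p → ℝ}
    (hδ : ∀ i, |(w i).1 ⬝ᵥ δ| ≤ c_L)
    (hcl : (δ, ∫ z, lossDiff m θ₀ (θ₀ + δ) z ∂P) ∈
      closure (Set.range fun k => (d k, ∫ z, lossDiff m θ₀ (θ₀ + d k) z ∂P))) :
    |centeredAvg P w (lossDiff m θ₀ (θ₀ + δ))| ≤ t := by
  obtain ⟨x, hx, hxlim⟩ := mem_closure_iff_seq_limit.1 hcl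
  choose k hk using hx
  obtain rfl : x = fun l => (d (k l), ∫ z, lossDiff m θ₀ (θ₀ + d (k l)) z ∂P) :=
    funext fun l => (hk l).symm
  have hlim₁ : Filter.Tendsto (fun l => d (k l)) Filter.atTop (nhds δ) := hxlim.fst_nhds
  have hlim₂ : Filter.Tendsto (fun l => ∫ z, lossDiff m θ₀ (θ₀ + d (k l)) z ∂P) Filter.atTop
      (nhds (∫ z, lossDiff m θ₀ (θ₀ + δ) z ∂P)) := hxlim.snd_nhds
  have hval (i) : Filter.Tendsto (fun l => lossDiff m θ₀ (θ₀ + d (k l)) (w i)) Filter.atTop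
      (nhds (lossDiff m θ₀ (θ₀ + δ) (w i))) := by
    rw [tendsto_iff_dist_tendsto_zero]
    have hdot : Continuous fun δ : Fin p → ℝ => (w i).1 ⬝ᵥ δ := by
      unfold dotProduct; fun_prop
    have h0 : Filter.Tendsto
        (fun l => (L (w i) : ℝ) * |(w i).1 ⬝ᵥ d (k l) - (w i).1 ⬝ᵥ δ|) Filter.atTop (nhds 0) := by
      have := (((hdot.tendsto δ).comp hlim₁).sub_const ((w i).1 ⬝ᵥ δ)).abs.const_mul (L (w i) : ℝ)
      simpa using this
    refine squeeze_zero (fun _ => dist_nonneg) (fun l => ?_) h0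
    rw [Real.dist_eq]
    exact abs_lossDiff_sub_le hL (hw i) (hd _ i) (hδ i)
  have hfin : Filter.Tendsto (fun l => |centeredAvg P w (lossDiff m θ₀ (θ₀ + d (k l)))|)
      Filter.atTop (nhds |centeredAvg P w (lossDiff m θ₀ (θ₀ + δ))|) :=
    (((tendsto_finsetSum _ fun i _ => hval i).const_mul _).sub hlim₂).abs
  exact le_of_tendsto' hfin fun l => hdt (k l)

end

end EmpiricalError

/-! ### The local empirical error -/

open EmpiricalError

theorem lemma1 {Ω 𝒴 : Type*} [MeasurableSpace Ω] [MeasurableSpace 𝒴]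
    (μ : Measure Ω) [IsProbabilityMeasure μ]
    (n p : ℕ) (hn : 3 ≤ n) (hp : 2 ≤ p)
    (P : Measure ((Fin p → ℝ) × 𝒴)) [IsProbabilityMeasure P]
    (𝒲 : Set ((Fin p → ℝ) × 𝒴)) (h𝒲 : ∀ᵐ w ∂P, w ∈ 𝒲)
    (W : Fin n → Ω → (Fin p → ℝ) × 𝒴) (hW : EmpiricalError.IsIIDSample μ P W)
    (m : ℝ → 𝒴 → ℝ) (hm : Measurable (Function.uncurry m))
    (Θ : Set (Fin p → ℝ)) (θ₀ : Fin p → ℝ) (hs : 1 ≤ EmpiricalError.sparsity θ₀)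
    (c₀ : ℝ) (hc₀ : 1 < c₀)
    (ζ B C_X : ℝ) (hX : EmpiricalError.CovariateCondition μ W ζ B C_X)
    (L : (Fin p → ℝ) × 𝒴 → ℝ≥0) (c_L C_L : ℝ)
    (hL : EmpiricalError.LocalLossCondition P 𝒲 m Θ θ₀ L c_L C_L)
    (hside : 16 * C_L ^ 2 / EmpiricalError.Ceps c₀ C_L C_X ^ 2 ≤
      EmpiricalError.sparsity θ₀ * Real.log (p * n))
    (u : ℝ) (hu : 0 < u)
    (hu' : u ≤ c_L / ((1 + EmpiricalError.cBar c₀) * B * √(EmpiricalError.sparsity θ₀))) :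
    EmpiricalError.WithProbAtLeast μ (1 - 5 / n - 8 * ζ)
      {ω | EmpiricalError.empiricalError P m Θ θ₀ c₀ (fun i => W i ω) u ≤
        ENNReal.ofReal (EmpiricalError.Ceps c₀ C_L C_X * u *
          √(EmpiricalError.sparsity θ₀ * Real.log (p * n) / n))} := by
  have hn0 : 0 < n := by omega
  have hp0 : 0 < p := by omega
  have hn' : (3 : ℝ) ≤ n := mod_cast hn
  have hp' : (2 : ℝ) ≤ p := mod_cast hp
  have hs' : (1 : ℝ) ≤ (sparsity θ₀ : ℕ) := mod_cast hs
  have hζ := hX.zeta_pos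
  have hCX := hX.C_X_pos
  have hB := hX.one_le_B
  have hCL := hL.C_L_pos
  have hc : 0 < cBar c₀ := div_pos (by linarith) (by linarith)
  have hlog : 0 < Real.log (p * n) := Real.log_pos (by nlinarith)
  have hceps : 0 < Ceps c₀ C_L C_X := by unfold Ceps; positivity
  set s : ℝ := (sparsity θ₀ : ℝ)
  set ℓ := Real.log (p * n)
  set t := Ceps c₀ C_L C_X * u * √(s * ℓ / n) with ht_def
  have hs0 : 0 < s := by linarith
  have ht : 0 < t := by positivity
  set R := (1 + cBar c₀) * √s * u with hR_def
  have hR : 0 < R := by positivity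
  have hsqrt : 1 ≤ √s := Real.one_le_sqrt.2 hs'
  have hBR : B * R ≤ c_L := by
    rw [le_div_iff₀ (by positivity)] at hu'
    calc B * R = u * ((1 + cBar c₀) * B * √s) := by rw [hR_def]; ring
      _ ≤ c_L := hu'
  have huc : u ≤ c_L := by
    refine le_trans ?_ hBR
    have h1 : 1 ≤ (1 + cBar c₀) * √s := one_le_mul_of_one_le_of_one_le (by linarith) hsqrt
    have h2 : u ≤ R := by rw [hR_def]; nlinarith
    nlinarith
  have ht2 : n * t ^ 2 = Ceps c₀ C_L C_X ^ 2 * u ^ 2 * (s * ℓ) := by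
    rw [ht_def, mul_pow, mul_pow, Real.sq_sqrt (by positivity)]; field_simp
  have hside' : 16 * (C_L ^ 2 * u ^ 2) ≤ n * t ^ 2 := by
    rw [div_le_iff₀ (by positivity)] at hside
    rw [ht2]
    nlinarith [mul_le_mul_of_nonneg_right hside (sq_nonneg u)]
  -- the exponent of the sub-Gaussian tail; any value at least `3 * ℓ` would do
  have hexp : (n * t / 4) ^ 2 / (2 * R ^ 2 * (n * C_L ^ 2 * C_X ^ 2 / 2)) = 32 * ℓ := by
    have h1 : (n * t / 4) ^ 2 = n / 16 * (n * t ^ 2) := by ring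
    have h2 : R ^ 2 = (1 + cBar c₀) ^ 2 * s * u ^ 2 := by
      rw [hR_def, mul_pow, mul_pow, Real.sq_sqrt hs0.le]
    have h3 : Ceps c₀ C_L C_X ^ 2 = 512 * (1 + cBar c₀) ^ 2 * C_L ^ 2 * C_X ^ 2 := by
      rw [Ceps, mul_pow, mul_pow, mul_pow, mul_pow, Real.sq_sqrt (by norm_num)]; ring
    rw [h1, ht2, h2, h3]
    field_simp
    norm_num
  -- a measurable set of full measure inside `𝒲`
  set 𝒲₀ := (toMeasurable P 𝒲ᶜ)ᶜ
  have h𝒲₀m : MeasurableSet 𝒲₀ := (measurableSet_toMeasurable _ _).compl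
  have h𝒲₀s : 𝒲₀ ⊆ 𝒲 := Set.compl_subset_comm.1 (subset_toMeasurable _ _)
  have h𝒲₀ : ∀ᵐ w ∂P, w ∈ 𝒲₀ := by
    change P 𝒲₀ᶜ = 0
    rw [compl_compl, measure_toMeasurable]
    exact mem_ae_iff.1 h𝒲
  have hL₀ : LocalLossCondition P 𝒲₀ m Θ θ₀ L c_L C_L :=
    { hL with lipschitz := fun w hw => hL.lipschitz w (h𝒲₀s hw) }
  -- `localSet` may be empty, since `θ₀` is not assumed to lie in `Θ`
  rcases (localSet Θ θ₀ (cBar c₀) u).eq_empty_or_nonempty with hemp | hne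
  · refine ⟨Set.univ, MeasurableSet.univ, fun ω _ => ?_, ?_⟩
    · rw [Set.mem_ofPred_eq, empiricalError]
      refine iSup₂_le fun δ hδ => ?_
      exact absurd (show δ ∈ localSet Θ θ₀ (cBar c₀) u from hδ) (by simp [hemp])
    · have : 0 ≤ 5 / (n : ℝ) := by positivity
      rw [probReal_univ]; linarith
  obtain ⟨d, hdmem, hdense⟩ := exists_seq_dense_graph hne
    fun δ => ∫ z, lossDiff m θ₀ (θ₀ + δ) z ∂P
  set Q := Measure.pi fun _ : Fin n => P
  set E : ℕ → Set (Fin n → (Fin p → ℝ) × 𝒴) :=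
    fun k => {w | t < |centeredAvg P w (lossDiff m θ₀ (θ₀ + d k))|} with hE
  have hEm (k) : MeasurableSet (E k) := by
    have := measurable_lossDiff hm θ₀ (θ₀ + d k)
    refine measurableSet_lt measurable_const (Measurable.abs ?_)
    unfold centeredAvg; fun_prop
  have hdev : Q.real {w | ∃ k, w ∈ E k} ≤ 8 / 3 * (1 / (9 * n) + (2 * ζ + 1 / n)) := by
    refine pi_real_exists_nat_le Q E fun N => ?_
    have h1 := pi_real_exists_lt_centeredAvg_le hn0 hp0 h𝒲₀m hm hL₀ (by linarith) hCX hR hBR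
      hu.le huc ht hside' (fun k : Fin N => d k) (fun k => hdmem k)
      (fun k => sum_abs_le_of_mem_localSet hc.le (hdmem k))
    have h2 := pi_real_regularSamples_compl_le hn0 h𝒲₀ hW hX hL.measurable_L hCL hL.moment
    have h3 := tail_le hn hp hexp
    change Q.real {w | ∃ k : Fin N, t < |centeredAvg P w (lossDiff m θ₀ (θ₀ + d k))|} ≤ _
    linarith
  have hEUm : MeasurableSet {w | ∃ k, w ∈ E k} := by
    rw [Set.ofPred_exists]; exact MeasurableSet.iUnion hEm
  have hbdm : MeasurableSet {w : Fin n → (Fin p → ℝ) × 𝒴 | ∀ i, ‖(w i).1‖ ≤ B} :=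
    measurableSet_forall_norm_le B
  have h𝒲m : MeasurableSet {w : Fin n → (Fin p → ℝ) × 𝒴 | ∀ i, w i ∈ 𝒲₀} :=
    measurableSet_forall_mem h𝒲₀m
  -- the bound on the covariates is needed a second time here, without symmetrization, to pass from
  -- the sequence `d` to the whole local set
  set A := ({w | ∃ k, w ∈ E k} ∪ {w | ∀ i, ‖(w i).1‖ ≤ B}ᶜ ∪ {w | ∀ i, w i ∈ 𝒲₀}ᶜ)ᶜ with hA
  have hAm : MeasurableSet A := ((hEUm.union hbdm.compl).union h𝒲m.compl).compl
  have hmp := hW.measurePreserving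
  refine ⟨_, hmp.measurable hAm, fun ω hω => ?_, ?_⟩
  · simp only [hA, Set.mem_preimage, Set.mem_compl_iff, Set.mem_union, not_or, not_not] at hω
    obtain ⟨⟨hωE, hωB⟩, hω𝒲⟩ := hω
    simp only [Set.mem_ofPred_eq] at hωB hω𝒲
    have hdot {δ : Fin p → ℝ} (hδ : δ ∈ localSet Θ θ₀ (cBar c₀) u) (i) :
        |(W i ω).1 ⬝ᵥ δ| ≤ c_L :=
      ((abs_dotProduct_le _ _).trans (mul_le_mul (hωB i)
        (sum_abs_le_of_mem_localSet hc.le hδ) (Finset.sum_nonneg fun _ _ => abs_nonneg _)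
        (by linarith))).trans hBR
    rw [Set.mem_ofPred_eq, empiricalError]
    refine iSup₂_le fun δ hδ => ENNReal.ofReal_le_ofReal ?_
    exact abs_centeredAvg_le_of_dense hL₀ hω𝒲 (fun k i => hdot (hdmem k) i)
      (fun k => not_lt.1 fun h => hωE ⟨k, h⟩) (fun i => hdot hδ i) (hdense δ hδ)
  · have hQ1 := WithProbAtLeast.real_compl_le hmp hbdm hX.bounded
    have hQ2 : Q.real {w | ∀ i, w i ∈ 𝒲₀}ᶜ = 0 := pi_real_forall_mem_compl_eq_zero h𝒲₀
    rw [hmp.measureReal_preimage hAm.nullMeasurableSet, hA,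
      probReal_compl_eq_one_sub ((hEUm.union hbdm.compl).union h𝒲m.compl)]
    have h1 := measureReal_union_le (μ := Q) ({w | ∃ k, w ∈ E k} ∪ {w | ∀ i, ‖(w i).1‖ ≤ B}ᶜ)
      {w | ∀ i, w i ∈ 𝒲₀}ᶜ
    have h2 := measureReal_union_le (μ := Q) {w | ∃ k, w ∈ E k} {w | ∀ i, ‖(w i).1‖ ≤ B}ᶜ
    have h3 : 8 / 3 * (1 / (9 * n) + (2 * ζ + 1 / n)) = 80 / 27 / n + 16 / 3 * ζ := by
      field_simp; ring
    have h4 : 80 / 27 / (n : ℝ) ≤ 5 / n := by gcongr; norm_num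
    linarith
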